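/- **Theorem (consistency of the volatility estimator when $H$ is known).** Let $H\in(0,\tfrac12)$, $x_0>0$, $a>0$, $\sigma>0$ and $T>0$. On a probability space, let $B^H=\{B^H(t),\,t\ge 0\}$ be a fractional Brownian motion with Hurst index $H$, i.e. a centred Gaussian process with $$\operatorname{Cov}(B^H(s),B^H(t))=\tfrac12\left(s^{2H}+t^{2H}-|t-s|^{2H}\right),\qquad s,t\ge 0,$$ and almost surely continuous paths. For $\varepsilon>0$ let $X^H_\varepsilon$ be the process with continuous paths that solves pathwise (outside a null set not depending on $\varepsilon$) $$X^H_\varepsilon(t)=x_0+\int_0^t\frac{a}{X^H_\varepsilon(s)\mathbf 1_{\{X^H_\varepsilon(s)>0\}}+\varepsilon}\,ds+\sigma B^H(t),\qquad t\ge 0.$$ Then, almost surely, the limit $$X^H(t):=\lim_{\varepsilon\downarrow 0}X^H_\varepsilon(t)$$ exists and is finite for all $t\ge 0$. Moreover, if this process $X^H$ (the rough Bessel process) is observed at the points $t_k=kT/n$, $k=0,\dots,n$, then the estimator $$\widehat\sigma_n=\frac1{T^H}\sqrt{n^{-1+2H}\,V^n_{1,2}(X^H)},\qquad V^n_{1,2}(X^H)=\sum_{k=0}^{n-1}\bigl(X^H(t_{k+1})-X^H(t_k)\bigr)^2,$$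 is weakly consistent for $\sigma$: $\widehat\sigma_n\to\sigma$ in probability as $n\to\infty$. -/

import Mathlib

open MeasureTheory ProbabilityTheory Filter Topology
open scoped NNReal

noncomputable section

/-- A fractional Brownian motion with Hurst index `H`: a centred Gaussian process on `[0, ∞)` with
covariance `(s ^ (2 H) + t ^ (2 H) - |t - s| ^ (2 H)) / 2` and almost surely continuous paths. -/
structure IsFractionalBrownianMotion {Ω : Type*} [MeasurableSpace Ω] (H : ℝ)
    (B : ℝ≥0 → Ω → ℝ) (P : Measure Ω) : Prop where
  isGaussianProcess : IsGaussianProcess B P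
  integral_eq_zero : ∀ t : ℝ≥0, ∫ ω, B t ω ∂P = 0
  covariance_eq : ∀ s t : ℝ≥0, cov[B s, B t; P] =
    ((s : ℝ) ^ (2 * H) + (t : ℝ) ^ (2 * H) - |(t : ℝ) - (s : ℝ)| ^ (2 * H)) / 2
  continuous_paths : ∀ᵐ ω ∂P, Continuous fun t => B t ω

/-- The drift `a / (x * 1_{x > 0} + ε)` of the pre-limit equation. -/
def preLimitDrift (a ε x : ℝ) : ℝ :=
  a / (x * (Set.Ioi (0 : ℝ)).indicator 1 x + ε)

/-- The continuous path `x` solves, on the whole of `[0, ∞)`, the pathwise integral equation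
`x t = x₀ + ∫₀ᵗ a / (x s * 1_{x s > 0} + ε) ds + σ * β t` driven by the path `β`. -/
def IsPreLimitPath (x₀ a σ ε : ℝ) (β x : ℝ≥0 → ℝ) : Prop :=
  Continuous x ∧ ∀ t : ℝ≥0,
    x t = x₀ + (∫ s in (0 : ℝ)..(t : ℝ), preLimitDrift a ε (x s.toNNReal)) + σ * β t

/-- The pointwise limit `X t = lim_{ε ↓ 0} X_ε t` of the pre-limit processes. -/
def roughBessel {Ω : Type*} (Xε : ℝ → ℝ≥0 → Ω → ℝ) (t : ℝ≥0) (ω : Ω) : ℝ :=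
  limUnder (𝓝[>] (0 : ℝ)) fun ε => Xε ε t ω

/-- The quadratic variation `∑_{k < n} (ξ (t_{k+1}) - ξ (t_k))²` of a path along the uniform
partition `t_k = k T / n` of `[0, T]`. -/
def quadVariation (T : ℝ≥0) (n : ℕ) (ξ : ℝ≥0 → ℝ) : ℝ :=
  ∑ k ∈ Finset.range n, (ξ (((k + 1 : ℕ) : ℝ≥0) * T / n) - ξ ((k : ℝ≥0) * T / n)) ^ 2

/-- The volatility estimator `T^{-H} √(n^{-1 + 2H} V_n(ξ))`, computed from the observed path. -/
def sigmaHat (H : ℝ) (T : ℝ≥0) (n : ℕ) (ξ : ℝ≥0 → ℝ) : ℝ :=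
  1 / (T : ℝ) ^ H * Real.sqrt ((n : ℝ) ^ (-1 + 2 * H) * quadVariation T n ξ)

end

/-! For a fixed continuous driving path the drift decreases in both the state and ε, so the
solutions are antitone in ε (`le_of_le`). Above level 1 the drift is at most `a`, so they are
bounded uniformly in ε (`sub_le_of_abs_le`), and the limit X exists.

Each X_ε - σB is nondecreasing, hence so is X - σB; no equation for X is needed. A monotone path has
quadratic variation at most the square of its total increase, uniformly in n. By Minkowski it
therefore shifts the estimator by O(n^(H - 1/2)), which vanishes for H < 1/2.

It remains to treat B alone. Its quadratic variation has mean n(T/n)^(2H), which is the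
normalisation of the estimator. For H < 1/2 distinct increments are negatively correlated, so the
variance is at most 4n(T/n)^(4H) (`variance_sum_sq_le`), and Chebyshev's inequality concludes. -/

/-! ### Gaussian fourth moments and sums of squares -/

/-- The fourth moment of a centred Gaussian random variable is three times its squared variance. -/
theorem integral_pow_four_gaussianReal (v : ℝ≥0) :
    ∫ x, x ^ 4 ∂gaussianReal 0 v = 3 * (v : ℝ) ^ 2 := by
  calc ∫ x, x ^ 4 ∂gaussianReal 0 v
      = iteratedDeriv 4 (mgf (fun x ↦ x) (gaussianReal 0 v)) 0 := by
        rw [iteratedDeriv_mgf_zero] <;> simp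
    _ = 3 * (v : ℝ) ^ 2 := by
        rw [mgf_fun_id_gaussianReal]
        simp only [zero_mul, zero_add]
        -- Differentiation turns the prefactor p of exp(vt²/2) into p' + vtp; four rounds start from
        -- p = 1.
        have key (p p' : ℝ → ℝ) (hp : ∀ t, HasDerivAt p (p' t) t) :
            deriv (fun t ↦ p t * Real.exp (v * t ^ 2 / 2)) =
              fun t ↦ (p' t + v * t * p t) * Real.exp (v * t ^ 2 / 2) := by
          ext t
          have h : HasDerivAt (fun t : ℝ ↦ (v : ℝ) * t ^ 2 / 2) (v * t) t := by
            have := (((hasDerivAt_id t).pow 2).const_mul (v : ℝ)).div_const 2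
            convert! this using 1
            simp
            ring
          rw [((hp t).fun_mul h.exp).deriv]
          ring
        have e0 : (fun t : ℝ ↦ Real.exp (v * t ^ 2 / 2)) =
            fun t ↦ (1 : ℝ) * Real.exp (v * t ^ 2 / 2) := by simp
        rw [iteratedDeriv_succ', iteratedDeriv_succ', iteratedDeriv_succ', iteratedDeriv_one, e0,
          key (fun _ ↦ 1) (fun _ ↦ 0) (fun t ↦ hasDerivAt_const t 1),
          key (fun t ↦ 0 + v * t * 1) (fun _ ↦ v) (fun t ↦ by
            simpa using (hasDerivAt_id t).const_mul (v : ℝ)),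
          key (fun t ↦ v + v * t * (0 + v * t * 1)) (fun t ↦ 2 * v ^ 2 * t) (fun t ↦ by
            have := (((hasDerivAt_id t).pow 2).const_mul ((v : ℝ) ^ 2)).const_add (v : ℝ)
            convert! this using 1
            · ext s
              simp
              ring
            · simp
              ring),
          key (fun t ↦ 2 * v ^ 2 * t + v * t * (v + v * t * (0 + v * t * 1)))
            (fun t ↦ 3 * v ^ 2 + 3 * v ^ 3 * t ^ 2) (fun t ↦ by
            have := ((hasDerivAt_id t).const_mul (3 * (v : ℝ) ^ 2)).add
              (((hasDerivAt_id t).pow 3).const_mul ((v : ℝ) ^ 3))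
            convert! this using 1
            · ext s
              simp
              ring
            · simp
              ring)]
        simp

section Gaussian

variable {Ω : Type*} [MeasurableSpace Ω] {P : Measure Ω}

theorem ProbabilityTheory.HasGaussianLaw.integral_pow_four {X : Ω → ℝ} (hX : HasGaussianLaw X P)
    (h0 : P[X] = 0) : ∫ ω, X ω ^ 4 ∂P = 3 * Var[X; P] ^ 2 := by
  have h := integral_pow_four_gaussianReal Var[X; P].toNNReal
  have hm := hX.map_eq_gaussianReal
  rw [h0] at hm
  rw [← hm, integral_map hX.aemeasurable (by fun_prop),
    Real.coe_toNNReal _ (variance_nonneg _ _)] at h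
  exact h

theorem ProbabilityTheory.HasGaussianLaw.memLp_sq {X : Ω → ℝ} (hX : HasGaussianLaw X P) :
    MemLp (fun ω ↦ X ω ^ 2) 2 P := by
  have h : MemLp X 4 P := hX.memLp (by simp)
  have := (h.mul (r := 2) (hpqr := ⟨by
    rw [← two_mul, show (4 : ENNReal) = 2 * 2 by norm_num, ENNReal.mul_inv (by simp) (by simp),
      ← mul_assoc, ENNReal.mul_inv_cancel (by simp) (by simp), one_mul]⟩) h)
  simpa [sq, Pi.mul_def] using this

/-- Isserlis' formula for the covariance of the squares of two centred jointly Gaussian random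
variables. -/
theorem covariance_sq_sq_of_hasGaussianLaw {X Y : Ω → ℝ}
    (hXY : HasGaussianLaw (fun ω ↦ (X ω, Y ω)) P) (hX : P[X] = 0) (hY : P[Y] = 0) :
    cov[fun ω ↦ X ω ^ 2, fun ω ↦ Y ω ^ 2; P] = 2 * cov[X, Y; P] ^ 2 := by
  have := hXY.isProbabilityMeasure
  have gX := hXY.fst
  have gY := hXY.snd
  have ga := hXY.fun_add
  have gs := hXY.fun_sub
  have i4 {Z : Ω → ℝ} (hZ : HasGaussianLaw Z P) : Integrable (fun ω ↦ Z ω ^ 4) P := by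
    have := hZ.memLp_sq.integrable_sq
    simpa [← pow_mul] using this
  have ma : P[fun ω ↦ X ω + Y ω] = 0 := by
    rw [integral_add gX.integrable gY.integrable, hX, hY, add_zero]
  have ms : P[fun ω ↦ X ω - Y ω] = 0 := by
    rw [integral_sub gX.integrable gY.integrable, hX, hY, sub_zero]
  have e1 := ga.integral_pow_four ma
  have e2 := gs.integral_pow_four ms
  have e3 := gX.integral_pow_four hX
  have e4 := gY.integral_pow_four hY
  rw [variance_fun_add gX.memLp_two gY.memLp_two] at e1
  rw [variance_fun_sub gX.memLp_two gY.memLp_two] at e2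
  -- Polarisation: (x+y)⁴ + (x-y)⁴ = 2x⁴ + 12x²y² + 2y⁴, so only fourth moments of single Gaussians
  -- are needed.
  have e5 : ∫ ω, X ω ^ 2 * Y ω ^ 2 ∂P = ((∫ ω, (X ω + Y ω) ^ 4 ∂P) + (∫ ω, (X ω - Y ω) ^ 4 ∂P)
      - 2 * (∫ ω, X ω ^ 4 ∂P) - 2 * ∫ ω, Y ω ^ 4 ∂P) / 12 := by
    rw [← integral_const_mul, ← integral_const_mul, ← integral_add (i4 ga) (i4 gs),
      ← integral_sub, ← integral_sub, ← integral_div]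
    rotate_left
    · exact ((i4 ga).add (i4 gs)).sub ((i4 gX).const_mul 2)
    · exact (i4 gY).const_mul 2
    · exact (i4 ga).add (i4 gs)
    · exact (i4 gX).const_mul 2
    congr with ω
    ring
  rw [covariance_eq_sub gX.memLp_sq gY.memLp_sq]
  have e6 := variance_of_integral_eq_zero gX.aemeasurable hX
  have e7 := variance_of_integral_eq_zero gY.aemeasurable hY
  simp only [Pi.mul_apply]
  rw [e5, e1, e2, e3, e4, ← e6, ← e7]
  ring

/-- The variance of a sum of squares of centred, equally distributed, pairwise jointly Gaussian and
pairwise negatively correlated random variables is at most linear in the number of terms. -/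
theorem variance_sum_sq_le {n : ℕ} {D : ℕ → Ω → ℝ} {v : ℝ}
    (hD : ∀ j k, HasGaussianLaw (fun ω ↦ (D j ω, D k ω)) P) (h0 : ∀ j, P[D j] = 0)
    (hv : ∀ j, Var[D j; P] = v) (hc : ∀ j k, j ≠ k → cov[D j, D k; P] ≤ 0) :
    Var[fun ω ↦ ∑ k ∈ Finset.range n, D k ω ^ 2; P] ≤ 4 * n * v ^ 2 := by
  have := (hD 0 0).isProbabilityMeasure
  have hL j : MemLp (D j) 2 P := (hD j j).fst.memLp_two
  have hcs j : cov[D j, D j; P] = v := by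
    rw [covariance_self (hL j).aemeasurable, hv]
  have hv0 : 0 ≤ v := hv 0 ▸ variance_nonneg _ _
  rw [variance_fun_sum' (fun i _ ↦ (hD i i).fst.memLp_sq)]
  simp_rw [fun i j ↦ covariance_sq_sq_of_hasGaussianLaw (hD i j) (h0 i) (h0 j)]
  -- Off the diagonal, Var(D j + D k) ≥ 0 gives -v ≤ c ≤ 0 for the covariance c, so c² ≤ -vc. The
  -- bound is linear in c and can be summed.
  have hpt j k : 2 * cov[D j, D k; P] ^ 2 ≤
      2 * v * ((if j = k then 2 * v else 0) - cov[D j, D k; P]) := by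
    split_ifs with h
    · subst h
      rw [hcs]
      nlinarith
    · have h1 := variance_nonneg (D j + D k) P
      rw [variance_add (hL j) (hL k), hv, hv] at h1
      nlinarith [hc j k h]
  -- The double sum is the variance of ∑ D k, so no decay of covariances is required.
  have hpos : 0 ≤ ∑ j ∈ Finset.range n, ∑ k ∈ Finset.range n, cov[D j, D k; P] := by
    rw [← variance_fun_sum' (fun i _ ↦ hL i)]
    exact variance_nonneg _ _
  calc ∑ j ∈ Finset.range n, ∑ k ∈ Finset.range n, 2 * cov[D j, D k; P] ^ 2
      ≤ ∑ j ∈ Finset.range n, ∑ k ∈ Finset.range n,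
        2 * v * ((if j = k then 2 * v else 0) - cov[D j, D k; P]) :=
        Finset.sum_le_sum fun j _ ↦ Finset.sum_le_sum fun k _ ↦ hpt j k
    _ = 2 * v * (2 * v * n - ∑ j ∈ Finset.range n, ∑ k ∈ Finset.range n, cov[D j, D k; P]) := by
        simp_rw [← Finset.mul_sum, Finset.sum_sub_distrib]
        congr 2
        rw [Finset.sum_congr rfl (fun j hj ↦ by rw [Finset.sum_ite_eq, if_pos hj])]
        simp [mul_comm]
    _ ≤ 4 * n * v ^ 2 := by
        nlinarith [mul_nonneg hv0 hpos]

end Gaussian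

/-! ### Increments of fractional Brownian motion -/

/-- Midpoint concavity of the power function; with p = 2H it gives the sign of the covariance of
grid increments. -/
theorem rpow_add_add_rpow_sub_le {p x h : ℝ} (hp0 : 0 ≤ p) (hp1 : p ≤ 1) (hh : 0 ≤ h)
    (hx : h ≤ x) : (x + h) ^ p + (x - h) ^ p ≤ 2 * x ^ p := by
  have h1 : x + h ∈ Set.Ici (0 : ℝ) := Set.mem_Ici.2 (by linarith)
  have h2 : x - h ∈ Set.Ici (0 : ℝ) := Set.mem_Ici.2 (by linarith)
  have h3 : (0 : ℝ) ≤ 1 / 2 := by norm_num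
  have := (Real.concaveOn_rpow hp0 hp1).2 h1 h2 h3 h3 (by norm_num)
  simp only [smul_eq_mul] at this
  rw [show (1 : ℝ) / 2 * (x + h) + 1 / 2 * (x - h) = x by ring] at this
  linarith

namespace IsFractionalBrownianMotion

variable {Ω : Type*} [MeasurableSpace Ω] {P : Measure Ω} {H : ℝ}
  {B : ℝ≥0 → Ω → ℝ}

theorem memLp_two (hB : IsFractionalBrownianMotion H B P) (t : ℝ≥0) : MemLp (B t) 2 P :=
  (hB.isGaussianProcess.hasGaussianLaw_eval t).memLp_two

theorem covariance_increments (hB : IsFractionalBrownianMotion H B P) (s t u v : ℝ≥0) :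
    cov[fun ω ↦ B t ω - B s ω, fun ω ↦ B v ω - B u ω; P] =
      (|(v : ℝ) - s| ^ (2 * H) + |(u : ℝ) - t| ^ (2 * H)
        - |(v : ℝ) - t| ^ (2 * H) - |(u : ℝ) - s| ^ (2 * H)) / 2 := by
  have := hB.isGaussianProcess.isProbabilityMeasure
  rw [covariance_fun_sub_fun_sub (hB.memLp_two t) (hB.memLp_two s) (hB.memLp_two v)
    (hB.memLp_two u)]
  simp_rw [hB.covariance_eq]
  ring

theorem integral_increment (hB : IsFractionalBrownianMotion H B P) (s t : ℝ≥0) :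
    ∫ ω, (B t ω - B s ω) ∂P = 0 := by
  have := hB.isGaussianProcess.isProbabilityMeasure
  rw [integral_sub ((hB.memLp_two t).integrable (by simp)) ((hB.memLp_two s).integrable (by simp)),
    hB.integral_eq_zero, hB.integral_eq_zero, sub_zero]

theorem variance_increment (hB : IsFractionalBrownianMotion H B P) (hH : 0 < H) (s t : ℝ≥0) :
    Var[fun ω ↦ B t ω - B s ω; P] = |(t : ℝ) - s| ^ (2 * H) := by
  rw [← covariance_self ((hB.memLp_two t).aemeasurable.fun_sub (hB.memLp_two s).aemeasurable),
    hB.covariance_increments, sub_self, sub_self, abs_zero, Real.zero_rpow (by positivity),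
    abs_sub_comm (s : ℝ) t]
  ring

/-- For `H < 1 / 2` the increments over distinct cells of a uniform grid are negatively
correlated. -/
theorem covariance_grid_nonpos (hB : IsFractionalBrownianMotion H B P) (hH0 : 0 < H)
    (hH : H < 1 / 2) {t : ℕ → ℝ≥0} {h : ℝ} (hh : 0 ≤ h) (ht : ∀ k, (t k : ℝ) = k * h) {j k : ℕ}
    (hjk : j ≠ k) :
    cov[fun ω ↦ B (t (j + 1)) ω - B (t j) ω, fun ω ↦ B (t (k + 1)) ω - B (t k) ω; P] ≤ 0 := by
  wlog hlt : j < k generalizing j k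
  · rw [covariance_comm]
    exact this hjk.symm (by omega)
  rw [hB.covariance_increments]
  simp only [ht]
  push_cast
  have hk : (j : ℝ) + 1 ≤ k := by exact_mod_cast hlt
  have hx : h ≤ ((k : ℝ) - j) * h := by nlinarith
  have := rpow_add_add_rpow_sub_le (p := 2 * H) (by linarith) (by linarith) hh hx
  rw [show ((k : ℝ) + 1) * h - j * h = (k - j) * h + h by ring,
    show (k : ℝ) * h - (j + 1) * h = (k - j) * h - h by ring,
    show ((k : ℝ) + 1) * h - (j + 1) * h = (k - j) * h by ring,
    show (k : ℝ) * h - j * h = (k - j) * h by ring, abs_of_nonneg (by linarith),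
    abs_of_nonneg (by linarith), abs_of_nonneg (by linarith)]
  linarith

theorem hasGaussianLaw_increments_prod (hB : IsFractionalBrownianMotion H B P) (s t u v : ℝ≥0) :
    HasGaussianLaw (fun ω ↦ (B t ω - B s ω, B v ω - B u ω)) P := by
  classical
  have h := hB.isGaussianProcess.hasGaussianLaw {s, t, u, v}
  let L : (({s, t, u, v} : Finset ℝ≥0) → ℝ) →L[ℝ] ℝ × ℝ :=
    { toFun x := (x ⟨t, by simp⟩ - x ⟨s, by simp⟩, x ⟨v, by simp⟩ - x ⟨u, by simp⟩)
      map_add' x y := by ext <;> simp <;> ring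
      map_smul' c x := by ext <;> simp <;> ring
      cont := by fun_prop }
  exact h.map L

end IsFractionalBrownianMotion

/-! ### Pathwise analysis of the regularised equation -/

theorem preLimitDrift_eq (a ε x : ℝ) : preLimitDrift a ε x = a / (max x 0 + ε) := by
  unfold preLimitDrift
  rcases le_or_gt x 0 with h | h
  · simp [Set.indicator, h, not_lt.2 h]
  · simp [Set.indicator, h, h.le]

theorem continuous_preLimitDrift (a : ℝ) {ε : ℝ} (hε : 0 < ε) :
    Continuous (preLimitDrift a ε) := by
  simp_rw [funext (preLimitDrift_eq a ε)]
  exact continuous_const.div (by fun_prop) fun x ↦ by positivity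

theorem preLimitDrift_nonneg {a ε : ℝ} (ha : 0 < a) (hε : 0 < ε) (x : ℝ) :
    0 ≤ preLimitDrift a ε x := by
  rw [preLimitDrift_eq]
  positivity

theorem preLimitDrift_le_preLimitDrift {a ε δ x y : ℝ} (ha : 0 < a) (hε : 0 < ε) (hεδ : ε ≤ δ)
    (hxy : x ≤ y) : preLimitDrift a δ y ≤ preLimitDrift a ε x := by
  rw [preLimitDrift_eq, preLimitDrift_eq]
  gcongr

theorem preLimitDrift_le {a ε x : ℝ} (ha : 0 < a) (hε : 0 < ε) (hx : 1 ≤ x) :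
    preLimitDrift a ε x ≤ a := by
  rw [preLimitDrift_eq, max_eq_left (by linarith)]
  exact div_le_self ha.le (by linarith)

/-- A continuous function that starts at or above the level `c` has a last time at or above `c` on
each interval `[0, t]`. -/
theorem exists_last_time_ge {f : ℝ → ℝ} (hf : Continuous f) {c t : ℝ} (ht : 0 ≤ t) (h0 : c ≤ f 0) :
    ∃ τ ∈ Set.Icc 0 t, c ≤ f τ ∧ ∀ s ∈ Set.Ioc τ t, f s < c := by
  have hK : IsCompact (Set.Icc 0 t ∩ f ⁻¹' Set.Ici c) :=
    isCompact_Icc.inter_right (isClosed_Ici.preimage hf)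
  obtain ⟨τ, ⟨hτ, hcτ⟩, hmax⟩ := hK.exists_isGreatest ⟨0, ⟨le_rfl, ht⟩, h0⟩
  refine ⟨τ, hτ, hcτ, fun s hs ↦ ?_⟩
  by_contra! hcs
  exact absurd (hmax ⟨⟨hτ.1.trans hs.1.le, hs.2⟩, hcs⟩) (not_le.2 hs.1)

namespace IsPreLimitPath

variable {x₀ a σ ε : ℝ} {β x : ℝ≥0 → ℝ}

theorem intervalIntegrable_drift (hx : IsPreLimitPath x₀ a σ ε β x) (hε : 0 < ε) (s t : ℝ) :
    IntervalIntegrable (fun r ↦ preLimitDrift a ε (x r.toNNReal)) volume s t :=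
  ((continuous_preLimitDrift a hε).comp
    (hx.1.comp continuous_real_toNNReal)).intervalIntegrable _ _

theorem sub_eq_integral (hx : IsPreLimitPath x₀ a σ ε β x) (hε : 0 < ε) (s t : ℝ≥0) :
    (x t - σ * β t) - (x s - σ * β s) =
      ∫ r in (s : ℝ)..(t : ℝ), preLimitDrift a ε (x r.toNNReal) := by
  rw [hx.2 t, hx.2 s, ← intervalIntegral.integral_interval_sub_left
    (hx.intervalIntegrable_drift hε 0 t) (hx.intervalIntegrable_drift hε 0 s)]
  ring

theorem monotone_sub (hx : IsPreLimitPath x₀ a σ ε β x) (ha : 0 < a) (hε : 0 < ε) :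
    Monotone fun t ↦ x t - σ * β t := by
  intro s t hst
  rw [← sub_nonneg, hx.sub_eq_integral hε]
  exact intervalIntegral.integral_nonneg (by exact_mod_cast hst)
    fun r _ ↦ preLimitDrift_nonneg ha hε _

theorem apply_zero (hx : IsPreLimitPath x₀ a σ ε β x) : x 0 = x₀ + σ * β 0 := by
  simpa using hx.2 0

/-- Comparison: the solution is antitone in the regularisation parameter. -/
theorem le_of_le {δ : ℝ} {y : ℝ≥0 → ℝ} (hx : IsPreLimitPath x₀ a σ ε β x)
    (hy : IsPreLimitPath x₀ a σ δ β y) (ha : 0 < a) (hε : 0 < ε) (hεδ : ε ≤ δ) (t : ℝ≥0) :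
    y t ≤ x t := by
  by_contra! hlt
  have hδ : 0 < δ := hε.trans_le hεδ
  -- After τ the path x lies below y, so its drift is at least that of y and x - y cannot become
  -- negative.
  obtain ⟨τ, hτ, h0, hs⟩ := exists_last_time_ge (f := fun s ↦ x s.toNNReal - y s.toNNReal)
    (c := 0) (t := t) ((hx.1.comp continuous_real_toNNReal).sub
      (hy.1.comp continuous_real_toNNReal)) t.2
    (by simp [hx.apply_zero, hy.apply_zero])
  lift τ to ℝ≥0 using hτ.1
  have e1 := hx.sub_eq_integral hε τ t
  have e2 := hy.sub_eq_integral hδ τ t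
  have hle : ∫ r in (τ : ℝ)..(t : ℝ), preLimitDrift a δ (y r.toNNReal) ≤
      ∫ r in (τ : ℝ)..(t : ℝ), preLimitDrift a ε (x r.toNNReal) :=
    intervalIntegral.integral_mono_on_of_le_Ioo hτ.2 (hy.intervalIntegrable_drift hδ _ _)
      (hx.intervalIntegrable_drift hε _ _) fun r hr ↦
        preLimitDrift_le_preLimitDrift ha hε hεδ (sub_neg.1 (hs r ⟨hr.1, hr.2.le⟩)).le
  simp only [Real.toNNReal_coe] at h0
  linarith

/-- A bound on the accumulated drift that does not depend on the regularisation parameter. -/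
theorem sub_le_of_abs_le (hx : IsPreLimitPath x₀ a σ ε β x) (ha : 0 < a) (hε : 0 < ε)
    (hσ : 0 < σ) (hx₀ : 0 < x₀) {K : ℝ} {t : ℝ≥0} (hK : ∀ s ≤ t, |β s| ≤ K) :
    x t - σ * β t ≤ 1 + x₀ + a * t + 4 * σ * K := by
  have hKt := abs_le.1 (hK t le_rfl)
  have hK0 := abs_le.1 (hK 0 zero_le)
  have m1 := mul_le_mul_of_nonneg_left hKt.1 hσ.le
  have m2 := mul_le_mul_of_nonneg_left hKt.2 hσ.le
  have m3 := mul_le_mul_of_nonneg_left hK0.2 hσ.le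
  have hat : 0 ≤ a * t := by positivity
  rcases le_or_gt (x t) (1 + x₀ + σ * K) with h | h
  · linarith
  -- τ is the last time x is at or below 1 + x₀ + σK. This level is at least x 0 and at least 1, so
  -- the drift after τ is at most a.
  obtain ⟨τ, hτ, h0, hs⟩ := exists_last_time_ge (f := fun s ↦ -x s.toNNReal)
    (c := -(1 + x₀ + σ * K)) (t := t) (hx.1.comp continuous_real_toNNReal).neg t.2
    (by simp [hx.apply_zero]; linarith)
  lift τ to ℝ≥0 using hτ.1
  have e1 := hx.sub_eq_integral hε τ t
  have hle : ∫ r in (τ : ℝ)..(t : ℝ), preLimitDrift a ε (x r.toNNReal) ≤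
      ∫ r in (τ : ℝ)..(t : ℝ), a :=
    intervalIntegral.integral_mono_on_of_le_Ioo hτ.2 (hx.intervalIntegrable_drift hε _ _)
      intervalIntegrable_const fun r hr ↦ preLimitDrift_le ha hε (by
        have := hs r ⟨hr.1, hr.2.le⟩
        linarith)
  rw [intervalIntegral.integral_const, smul_eq_mul] at hle
  simp only [Real.toNNReal_coe] at h0
  have hKτ := abs_le.1 (hK τ (by exact_mod_cast hτ.2))
  have m4 := mul_le_mul_of_nonneg_left hKτ.1 hσ.le
  have : (t - τ) * a ≤ a * t := by nlinarith [τ.2, mul_nonneg τ.2 ha.le]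
  linarith

end IsPreLimitPath

/-- The pre-limit paths driven by a continuous path converge as the regularisation vanishes. -/
theorem exists_tendsto_of_isPreLimitPath {x₀ a σ : ℝ} {β : ℝ≥0 → ℝ} {x : ℝ → ℝ≥0 → ℝ}
    (hx₀ : 0 < x₀) (ha : 0 < a) (hσ : 0 < σ) (hβ : Continuous β)
    (hx : ∀ ε, 0 < ε → IsPreLimitPath x₀ a σ ε β (x ε)) (t : ℝ≥0) :
    ∃ l, Tendsto (fun ε ↦ x ε t) (𝓝[>] (0 : ℝ)) (𝓝 l) := by
  obtain ⟨K, hK⟩ := (isCompact_Icc (a := (0 : ℝ≥0)) (b := t)).exists_bound_of_continuousOn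
    hβ.continuousOn
  refine ⟨_, AntitoneOn.tendsto_nhdsGT (f := fun ε ↦ x ε t) (x := 0) ?_ ?_⟩
  · intro ε hε δ hδ hεδ
    exact (hx ε hε).le_of_le (hx δ hδ) ha hε hεδ t
  · refine ⟨1 + x₀ + a * t + 4 * σ * K + σ * β t, ?_⟩
    rintro _ ⟨ε, hε, rfl⟩
    have := (hx ε hε).sub_le_of_abs_le ha hε hσ hx₀ (K := K) (t := t)
      fun s hs ↦ hK s ⟨zero_le, hs⟩
    simp only
    linarith

/-! ### Path estimates: quadratic variation and running bounds -/

theorem norm_toLp_increments (T : ℝ≥0) (n : ℕ) (ξ : ℝ≥0 → ℝ) :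
    ‖WithLp.toLp 2 (fun k : Fin n ↦
      ξ ((((k : ℕ) + 1 : ℕ) : ℝ≥0) * T / n) - ξ (((k : ℕ) : ℝ≥0) * T / n))‖ =
      √(quadVariation T n ξ) := by
  rw [EuclideanSpace.norm_eq, quadVariation, Finset.sum_range]
  simp

theorem quadVariation_const_mul (T : ℝ≥0) (n : ℕ) (c : ℝ) (ξ : ℝ≥0 → ℝ) :
    quadVariation T n (fun t ↦ c * ξ t) = c ^ 2 * quadVariation T n ξ := by
  simp_rw [quadVariation, Finset.mul_sum, ← mul_sub, mul_pow]

/-- Minkowski's inequality for the square root of the quadratic variation. -/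
theorem abs_sqrt_quadVariation_sub_le (T : ℝ≥0) (n : ℕ) (ξ η : ℝ≥0 → ℝ) :
    |√(quadVariation T n ξ) - √(quadVariation T n η)| ≤
      √(quadVariation T n fun t ↦ ξ t - η t) := by
  simp_rw [← norm_toLp_increments]
  refine (abs_norm_sub_norm_le _ _).trans (le_of_eq ?_)
  rw [← WithLp.toLp_sub]
  congr 2
  ext k
  simp only [Pi.sub_apply]
  ring

/-- For nonnegative increments the sum of squares is at most the square of the sum, which
telescopes. -/
theorem sqrt_quadVariation_le_of_monotone (T : ℝ≥0) (n : ℕ) {ξ : ℝ≥0 → ℝ} (hξ : Monotone ξ) :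
    √(quadVariation T n ξ) ≤ ξ T - ξ 0 := by
  have hstep (k : ℕ) : ξ ((k : ℝ≥0) * T / n) ≤ ξ (((k + 1 : ℕ) : ℝ≥0) * T / n) := by
    apply hξ
    gcongr
    exact Nat.le_succ k
  refine Real.sqrt_le_iff.2 ⟨sub_nonneg.2 (hξ zero_le), ?_⟩
  rcases Nat.eq_zero_or_pos n with rfl | hn
  · simp [quadVariation, sq_nonneg]
  have hn' : (n : ℝ≥0) ≠ 0 := by positivity
  refine (Finset.sum_sq_le_sq_sum_of_nonneg fun k _ ↦ sub_nonneg.2 (hstep k)).trans (le_of_eq ?_)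
  rw [Finset.sum_range_sub (fun k : ℕ ↦ ξ ((k : ℝ≥0) * T / n)) n]
  simp [mul_div_cancel_left₀ T hn']

/-- Adding a monotone perturbation to the observed path changes the estimator by a vanishing
amount. -/
theorem abs_sigmaHat_sub_le {H σ : ℝ} (hσ : 0 < σ) (T : ℝ≥0) (n : ℕ) {ξ β : ℝ≥0 → ℝ}
    (h : Monotone fun t ↦ ξ t - σ * β t) :
    |sigmaHat H T n ξ - σ * sigmaHat H T n β| ≤
      1 / (T : ℝ) ^ H * √((n : ℝ) ^ (-1 + 2 * H)) * ((ξ T - σ * β T) - (ξ 0 - σ * β 0)) := by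
  have h1 := abs_sqrt_quadVariation_sub_le T n ξ (fun t ↦ σ * β t)
  have h2 := h1.trans (sqrt_quadVariation_le_of_monotone T n h)
  rw [quadVariation_const_mul, Real.sqrt_mul (sq_nonneg σ), Real.sqrt_sq hσ.le] at h2
  have hc : 0 ≤ 1 / (T : ℝ) ^ H * √((n : ℝ) ^ (-1 + 2 * H)) := by positivity
  unfold sigmaHat
  rw [Real.sqrt_mul (by positivity), Real.sqrt_mul (by positivity)]
  calc _ = 1 / (T : ℝ) ^ H * √((n : ℝ) ^ (-1 + 2 * H)) *
        |√(quadVariation T n ξ) - σ * √(quadVariation T n β)| := by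
        conv_rhs => rw [← abs_of_nonneg hc, ← abs_mul]
        congr 1
        ring
    _ ≤ _ := by gcongr

/-- The running maximum of the modulus of an almost surely continuous process has a measurable
almost sure bound. -/
theorem exists_aemeasurable_abs_le {Ω : Type*} [MeasurableSpace Ω] {P : Measure Ω}
    {B : ℝ≥0 → Ω → ℝ} (hm : ∀ t, AEMeasurable (B t) P)
    (hc : ∀ᵐ ω ∂P, Continuous fun t ↦ B t ω) (T : ℝ≥0) :
    ∃ K : Ω → ℝ, AEMeasurable K P ∧ ∀ᵐ ω ∂P, ∀ s ≤ T, |B s ω| ≤ K ω := by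
  -- A countable supremum over dense times, capped at T, is measurable; path continuity extends the
  -- bound to all s ≤ T.
  refine ⟨fun ω ↦ (⨆ n : ℕ, ‖B (min (TopologicalSpace.denseSeq ℝ≥0 n) T) ω‖ₑ).toReal,
    (AEMeasurable.iSup fun n ↦ (hm _).enorm).ennreal_toReal, ?_⟩
  filter_upwards [hc] with ω hω s hs
  set K := ⨆ n : ℕ, ‖B (min (TopologicalSpace.denseSeq ℝ≥0 n) T) ω‖ₑ with hK
  have hfin : K ≠ ⊤ := by
    obtain ⟨C, hC⟩ := (isCompact_Icc (a := (0 : ℝ≥0)) (b := T)).exists_bound_of_continuousOn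
      hω.continuousOn
    refine ne_top_of_le_ne_top (b := ENNReal.ofReal C) ENNReal.ofReal_ne_top (iSup_le fun n ↦ ?_)
    rw [← ofReal_norm]
    exact ENNReal.ofReal_le_ofReal (hC _ ⟨zero_le, min_le_right _ _⟩)
  have hclosed : IsClosed {t : ℝ≥0 | ‖B (min t T) ω‖ₑ ≤ K} :=
    isClosed_le ((hω.comp (continuous_id.min continuous_const)).enorm) continuous_const
  have hmem : s ∈ {t : ℝ≥0 | ‖B (min t T) ω‖ₑ ≤ K} := by
    have hsub : Set.range (TopologicalSpace.denseSeq ℝ≥0) ⊆ {t : ℝ≥0 | ‖B (min t T) ω‖ₑ ≤ K} := by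
      rintro _ ⟨n, rfl⟩
      exact le_iSup (fun n : ℕ ↦ ‖B (min (TopologicalSpace.denseSeq ℝ≥0 n) T) ω‖ₑ) n
    exact closure_minimal hsub hclosed (TopologicalSpace.denseRange_denseSeq ℝ≥0 s)
  rw [Set.mem_ofPred_eq, min_eq_left hs] at hmem
  have := ENNReal.toReal_mono hfin hmem
  rwa [toReal_enorm, Real.norm_eq_abs] at this

/-! ### Law of large numbers for fractional Brownian motion -/

theorem abs_sqrt_sub_one_le {w : ℝ} (hw : 0 ≤ w) : |√w - 1| ≤ |w - 1| := by
  have h : w - 1 = (√w - 1) * (√w + 1) := by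
    nlinarith [Real.mul_self_sqrt hw]
  rw [h, abs_mul]
  exact le_mul_of_one_le_right (abs_nonneg _)
    ((by linarith [Real.sqrt_nonneg w] : 1 ≤ √w + 1).trans (le_abs_self _))

/-- The denominator is the mean of the quadratic variation of B, so the radicand has mean 1 when ξ
is a path of B. -/
theorem sigmaHat_eq_sqrt_div {H : ℝ} {T : ℝ≥0} (hT : 0 < T) {n : ℕ} (hn : 0 < n) (ξ : ℝ≥0 → ℝ) :
    sigmaHat H T n ξ = √(quadVariation T n ξ / (n * ((T : ℝ) / n) ^ (2 * H))) := by
  have hT' : (0 : ℝ) < T := hT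
  have hn' : (0 : ℝ) < n := by exact_mod_cast hn
  have h1 : (1 : ℝ) / (T : ℝ) ^ H = √(1 / (T : ℝ) ^ (2 * H)) := by
    rw [mul_comm, Real.rpow_mul hT'.le, Real.rpow_two, ← one_div_pow, Real.sqrt_sq (by positivity)]
  rw [sigmaHat, h1, ← Real.sqrt_mul (by positivity)]
  congr 1
  rw [Real.div_rpow hT'.le hn'.le, Real.rpow_add hn', Real.rpow_neg_one]
  have := Real.rpow_pos_of_pos hn' (2 * H)
  have := Real.rpow_pos_of_pos hT' (2 * H)
  field_simp

namespace IsFractionalBrownianMotion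

variable {Ω : Type*} [MeasurableSpace Ω] {P : Measure Ω} {H : ℝ} {B : ℝ≥0 → Ω → ℝ}

theorem variance_grid_increment (hB : IsFractionalBrownianMotion H B P) (hH0 : 0 < H) (T : ℝ≥0)
    (n k : ℕ) :
    Var[fun ω ↦ B (((k + 1 : ℕ) : ℝ≥0) * T / n) ω - B ((k : ℝ≥0) * T / n) ω; P] =
      ((T : ℝ) / n) ^ (2 * H) := by
  rw [hB.variance_increment hH0]
  push_cast
  rw [show ((k : ℝ) + 1) * T / n - k * T / n = T / n by ring, abs_of_nonneg (by positivity)]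

theorem integral_quadVariation (hB : IsFractionalBrownianMotion H B P) (hH0 : 0 < H) (T : ℝ≥0)
    (n : ℕ) :
    ∫ ω, quadVariation T n (fun t ↦ B t ω) ∂P = n * ((T : ℝ) / n) ^ (2 * H) := by
  unfold quadVariation
  rw [integral_finsetSum _ fun k _ ↦
    (hB.hasGaussianLaw_increments_prod _ _ 0 0).fst.memLp_two.integrable_sq]
  simp_rw [← variance_of_integral_eq_zero
    ((hB.memLp_two _).aemeasurable.fun_sub (hB.memLp_two _).aemeasurable)
    (hB.integral_increment _ _), hB.variance_grid_increment hH0 T n]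
  simp

theorem variance_quadVariation_le (hB : IsFractionalBrownianMotion H B P) (hH0 : 0 < H)
    (hH : H < 1 / 2) (T : ℝ≥0) (n : ℕ) :
    Var[fun ω ↦ quadVariation T n (fun t ↦ B t ω); P] ≤
      4 * n * (((T : ℝ) / n) ^ (2 * H)) ^ 2 :=
  variance_sum_sq_le (fun j k ↦ hB.hasGaussianLaw_increments_prod _ _ _ _)
    (fun j ↦ hB.integral_increment _ _) (hB.variance_grid_increment hH0 T n)
    fun j k hjk ↦ hB.covariance_grid_nonpos hH0 hH (t := fun k : ℕ ↦ (k : ℝ≥0) * T / n)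
      (h := T / n) (by positivity) (fun k ↦ by push_cast; ring) hjk

theorem memLp_quadVariation (hB : IsFractionalBrownianMotion H B P) (T : ℝ≥0) (n : ℕ) :
    MemLp (fun ω ↦ quadVariation T n (fun t ↦ B t ω)) 2 P :=
  memLp_finsetSum _ fun _ _ ↦
    (hB.hasGaussianLaw_increments_prod _ _ 0 0).fst.memLp_sq

/-- The estimator computed from the fractional Brownian motion itself tends to `1`. -/
theorem tendstoInMeasure_sigmaHat (hB : IsFractionalBrownianMotion H B P) (hH0 : 0 < H)
    (hH : H < 1 / 2) {T : ℝ≥0} (hT : 0 < T) :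
    TendstoInMeasure P (fun (n : ℕ) ω ↦ sigmaHat H T n fun t ↦ B t ω) atTop fun _ ↦ 1 := by
  have := hB.isGaussianProcess.isProbabilityMeasure
  rw [tendstoInMeasure_iff_norm]
  intro δ hδ
  have hlim : Tendsto (fun n : ℕ ↦ ENNReal.ofReal (4 / δ ^ 2 / n)) atTop (𝓝 0) := by
    rw [← ENNReal.ofReal_zero]
    exact ENNReal.tendsto_ofReal (tendsto_const_div_atTop_nhds_zero_nat _)
  refine tendsto_of_tendsto_of_tendsto_of_le_of_le' tendsto_const_nhds hlim
    (Eventually.of_forall fun _ ↦ zero_le) ?_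
  filter_upwards [eventually_gt_atTop 0] with n hn
  have hT' : (0 : ℝ) < T := hT
  have hn' : (0 : ℝ) < n := by exact_mod_cast hn
  set v := ((T : ℝ) / n) ^ (2 * H) with hv
  have hvpos : 0 < v := by positivity
  have hmean := hB.integral_quadVariation hH0 T n
  -- The threshold is δ times the mean nv, so the bound becomes 4nv²/(δnv)² = 4/(δ²n).
  have hcheb := meas_ge_le_variance_div_sq (hB.memLp_quadVariation T n)
    (c := δ * (n * v)) (by positivity)
  rw [hmean] at hcheb
  refine (measure_mono fun ω hω ↦ ?_).trans (hcheb.trans (ENNReal.ofReal_le_ofReal ?_))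
  · rw [Set.mem_ofPred_eq, sigmaHat_eq_sqrt_div hT hn, Real.norm_eq_abs] at hω
    have hq : 0 ≤ quadVariation T n fun t ↦ B t ω := Finset.sum_nonneg fun _ _ ↦ sq_nonneg _
    have h := hω.trans (abs_sqrt_sub_one_le (by positivity))
    rw [div_sub_one (by positivity), abs_div, abs_of_pos (show 0 < n * v by positivity),
      le_div_iff₀ (by positivity)] at h
    exact h
  · calc _ ≤ 4 * n * v ^ 2 / (δ * (n * v)) ^ 2 := by
          gcongr
          exact hB.variance_quadVariation_le hH0 hH T n
      _ = 4 / δ ^ 2 / n := by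
          field_simp

end IsFractionalBrownianMotion

/-! ### Consistency for the rough Bessel process -/

theorem mainTheorem3 {Ω : Type*} [MeasurableSpace Ω] (P : Measure Ω) [IsProbabilityMeasure P]
    (H x₀ a σ : ℝ) (T : ℝ≥0) (hH0 : 0 < H) (hH : H < 1 / 2) (hx₀ : 0 < x₀) (ha : 0 < a)
    (hσ : 0 < σ) (hT : 0 < T)
    (B : ℝ≥0 → Ω → ℝ) (hB : IsFractionalBrownianMotion H B P)
    (Xε : ℝ → ℝ≥0 → Ω → ℝ)
    (hXε : ∀ᵐ ω ∂P, ∀ ε : ℝ, 0 < ε →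
      IsPreLimitPath x₀ a σ ε (fun t => B t ω) (fun t => Xε ε t ω)) :
    (∀ᵐ ω ∂P, ∀ t : ℝ≥0,
      Tendsto (fun ε => Xε ε t ω) (𝓝[>] (0 : ℝ)) (𝓝 (roughBessel Xε t ω))) ∧
    TendstoInMeasure P
      (fun (n : ℕ) (ω : Ω) => sigmaHat H T n (fun t => roughBessel Xε t ω))
      atTop (fun _ => σ) := by
  have hlim : ∀ᵐ ω ∂P, ∀ t : ℝ≥0,
      Tendsto (fun ε => Xε ε t ω) (𝓝[>] (0 : ℝ)) (𝓝 (roughBessel Xε t ω)) := by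
    filter_upwards [hXε, hB.continuous_paths] with ω hω hc t
    exact tendsto_nhds_limUnder
      (exists_tendsto_of_isPreLimitPath (x := fun ε t ↦ Xε ε t ω) hx₀ ha hσ hc hω t)
  refine ⟨hlim, ?_⟩
  -- Measurability of K lets the almost sure convergence of the error bound pass to convergence in
  -- measure.
  obtain ⟨K, hKm, hK⟩ := exists_aemeasurable_abs_le
    (fun t ↦ hB.isGaussianProcess.aemeasurable t) hB.continuous_paths T
  have hbound : ∀ᵐ ω ∂P, ∀ n : ℕ,
      |sigmaHat H T n (fun t ↦ roughBessel Xε t ω) - σ * sigmaHat H T n (fun t ↦ B t ω)| ≤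
        1 / (T : ℝ) ^ H * √((n : ℝ) ^ (-1 + 2 * H)) * (1 + a * T + 4 * σ * K ω) := by
    filter_upwards [hXε, hlim, hK] with ω hω hl hKω n
    have hl' t : Tendsto (fun ε ↦ Xε ε t ω - σ * B t ω) (𝓝[>] (0 : ℝ))
        (𝓝 (roughBessel Xε t ω - σ * B t ω)) := (hl t).sub_const _
    have hmono : Monotone fun t ↦ roughBessel Xε t ω - σ * B t ω := fun s t hst ↦
      le_of_tendsto_of_tendsto (hl' s) (hl' t) (eventually_nhdsWithin_of_forall fun ε hε ↦
        (hω ε hε).monotone_sub ha hε hst)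
    refine (abs_sigmaHat_sub_le hσ T n hmono).trans (mul_le_mul_of_nonneg_left ?_ (by positivity))
    have h0 : x₀ ≤ roughBessel Xε 0 ω - σ * B 0 ω :=
      ge_of_tendsto (hl' 0) (eventually_nhdsWithin_of_forall fun ε hε ↦ by
        simp [(hω ε hε).apply_zero])
    have hT1 : roughBessel Xε T ω - σ * B T ω ≤ 1 + x₀ + a * T + 4 * σ * K ω :=
      le_of_tendsto (hl' T) (eventually_nhdsWithin_of_forall fun ε hε ↦
        (hω ε hε).sub_le_of_abs_le ha hε hσ hx₀ hKω)
    linarith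
  have herr : TendstoInMeasure P (fun (n : ℕ) ω ↦
      1 / (T : ℝ) ^ H * √((n : ℝ) ^ (-1 + 2 * H)) * (1 + a * T + 4 * σ * K ω)) atTop
      fun _ ↦ (0 : ℝ) := by
    refine tendstoInMeasure_of_tendsto_ae (fun n ↦ ?_) (Eventually.of_forall fun ω ↦ ?_)
    · exact (((hKm.const_mul (4 * σ)).const_add (1 + a * T)).const_mul _).aestronglyMeasurable
    · have h1 : Tendsto (fun n : ℕ ↦ (n : ℝ) ^ (-1 + 2 * H)) atTop (𝓝 0) := by
        have := (tendsto_rpow_neg_atTop (y := 1 - 2 * H) (by linarith)).comp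
          (tendsto_natCast_atTop_atTop (R := ℝ))
        simpa [Function.comp_def, neg_sub, sub_eq_add_neg, add_comm] using this
      have h2 := ((h1.sqrt.const_mul (1 / (T : ℝ) ^ H)).mul_const (1 + a * T + 4 * σ * K ω))
      simpa using h2
  have hfbm := hB.tendstoInMeasure_sigmaHat hH0 hH hT
  rw [tendstoInMeasure_iff_norm] at herr hfbm ⊢
  intro δ hδ
  have hsum := (herr (δ / 2) (by positivity)).add (hfbm (δ / 2 / σ) (by positivity))
  rw [add_zero] at hsum
  refine tendsto_of_tendsto_of_tendsto_of_le_of_le tendsto_const_nhds hsum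
    (fun _ ↦ zero_le) fun n ↦ ?_
  -- A deviation of at least δ forces the perturbation error to reach δ/2 or the estimator for B to
  -- deviate from 1 by δ/(2σ).
  refine (measure_mono_ae ?_).trans (measure_union_le _ _)
  filter_upwards [hbound] with ω hω hmem
  by_contra hnot
  change ω ∉ (_ ∪ _ : Set Ω) at hnot
  simp only [Set.mem_union, Set.mem_ofPred_eq, Real.norm_eq_abs, sub_zero, not_or, not_le] at hnot
  change ω ∈ {x | δ ≤ ‖_ - σ‖} at hmem
  rw [Set.mem_ofPred_eq, Real.norm_eq_abs] at hmem
  obtain ⟨h1, h2⟩ := hnot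
  have h3 := (hω n).trans_lt ((le_abs_self _).trans_lt h1)
  rw [lt_div_iff₀ hσ] at h2
  have h4 : |σ * sigmaHat H T n (fun t ↦ B t ω) - σ| < δ / 2 := by
    rwa [← mul_sub_one, abs_mul, abs_of_pos hσ, mul_comm]
  have := abs_sub_le (sigmaHat H T n (fun t ↦ roughBessel Xε t ω))
    (σ * sigmaHat H T n (fun t ↦ B t ω)) σ
  linarith
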